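/- Let $G$ be a finite connected simple graph that is not isomorphic to any of the cycles $C_3$, $C_4$, $C_5$ or to the claw $K_{1,3}$. Let $L(G)$ denote the line graph of $G$ (its vertices are the edges of $G$, and two distinct edges of $G$ are adjacent in $L(G)$ if they share an endpoint), and put $L^0(G)=G$ and $L^{k}(G)=L(L^{k-1}(G))$ for $k\ge 1$. For a finite graph $H$, a map $f:V(H)\to\{1,\dots,d\}$ distinguishes $H$ if for every nontrivial automorphism $\phi$ of $H$ there is a vertex $v$ with $f(v)\ne f(\phi(v))$, and the distinguishing number $D(H)$ is the least $d\ge 0$ for which such a map exists (so $D(H)=0$ if $H$ has no vertices). Then there exists a natural number $K$ such that $D(L^k(G))\le 2$ for all $k\ge K$. -/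

import Mathlib

universe u

namespace SimpleGraph

/-- A vertex colouring `f` distinguishes `G` if every nontrivial automorphism of `G` moves some
vertex to a vertex of a different colour. -/
def Distinguishes {V : Type u} {C : Type*} (G : SimpleGraph V) (f : V → C) : Prop :=
  ∀ φ : G ≃g G, φ ≠ Iso.refl → ∃ v : V, f v ≠ f (φ v)

/-- The distinguishing number `D(G)`: the least `k` for which some map from the vertices to a
`k`-element set of colours distinguishes `G` (and `⊤` if no finite number of colours suffices,
which does not happen for finite graphs). -/
noncomputable def distinguishingNumber {V : Type u} (G : SimpleGraph V) : ℕ∞ :=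
  ⨅ k ∈ {k : ℕ | ∃ f : V → Fin k, G.Distinguishes f}, (k : ℕ∞)

/-- The `k`-th iterated line graph, bundled with its vertex type:
`L⁰(G) = G` and `Lᵏ⁺¹(G) = L(Lᵏ(G))`. -/
def iteratedLineGraph {V : Type u} (G : SimpleGraph V) : ℕ → Σ W : Type u, SimpleGraph W
  | 0 => ⟨V, G⟩
  | k + 1 => ⟨(iteratedLineGraph G k).2.edgeSet, (iteratedLineGraph G k).2.lineGraph⟩

end SimpleGraph

/-! The proof splits by degrees. If all degrees are at most 2, the graph is a path, whose iterates
eventually become empty, or a cycle of length at least 6, which is its own line graph and has a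
two-colouring that breaks its symmetry. The excluded short cycles need three colours, and the line
graph of the claw is a triangle.

If some degree is at least 3, the claw being excluded, some edge has degree at least 3 in the line
graph. The number of vertices of degree at most 2 can then be driven to zero by taking line graphs
(`ncard_lowVerts_lineGraph_lt`). One further line graph has minimum degree at least 4. From there
the minimum degree keeps growing, while by Whitney's theorem (`exists_iso_of_lineGraph_iso`) the
automorphism group does not. Each nontrivial automorphism of a late iterate moves a large set off
itself, so a random two-colouring is unlikely to be preserved by it, and a union bound over the
group (`distinguishingNumber_le_two_of_card_iso_lt`) gives a distinguishing one. -/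

namespace SimpleGraph

/-! ### Stars, degrees and connectedness in line graphs. -/

variable {V : Type u} {G : SimpleGraph V}

/-- The number of neighbours of a vertex, as an instance-free version of `SimpleGraph.degree`. -/
noncomputable def valency (G : SimpleGraph V) (v : V) : ℕ := (G.neighborSet v).ncard

lemma valency_eq_degree (v : V) [Fintype (G.neighborSet v)] : G.valency v = G.degree v := by
  rw [valency, Set.ncard_eq_toFinset_card', ← neighborFinset_def, card_neighborFinset_eq_degree]

lemma ncard_incidenceSet (v : V) : (G.incidenceSet v).ncard = G.valency v := by
  classical
  exact Nat.card_congr (G.incidenceSetEquivNeighborSet v)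

/-- The star at `v`, as a set of vertices of the line graph. -/
def star (G : SimpleGraph V) (v : V) : Set G.edgeSet := {e | v ∈ (e : Sym2 V)}

lemma mem_star {v : V} {e : G.edgeSet} : e ∈ G.star v ↔ v ∈ (e : Sym2 V) := Iff.rfl

lemma val_image_star (v : V) : Subtype.val '' G.star v = G.incidenceSet v := by
  ext e
  simp only [Set.mem_image, Subtype.exists, exists_and_right, exists_eq_right, mem_star,
    incidenceSet, Set.mem_ofPred_eq]
  exact ⟨fun ⟨h, h'⟩ => ⟨h, h'⟩, fun ⟨h, h'⟩ => ⟨h, h'⟩⟩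

lemma ncard_star (v : V) : (G.star v).ncard = G.valency v := by
  rw [← ncard_incidenceSet, ← val_image_star, Set.ncard_image_of_injective _ Subtype.val_injective]

lemma eq_of_mem_star {u v : V} (huv : u ≠ v) {e f : G.edgeSet} (heu : e ∈ G.star u)
    (hev : e ∈ G.star v) (hfu : f ∈ G.star u) (hfv : f ∈ G.star v) : e = f :=
  Subtype.ext <| ((Sym2.mem_and_mem_iff huv).1 ⟨heu, hev⟩).trans
    ((Sym2.mem_and_mem_iff huv).1 ⟨hfu, hfv⟩).symm

/-- The stars at the two ends share only the edge itself, which each of them counts once. -/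
lemma valency_lineGraph [Finite V] {u v : V} (h : G.Adj u v) :
    G.lineGraph.valency ⟨s(u, v), h⟩ + 2 = G.valency u + G.valency v := by
  set e : G.edgeSet := ⟨s(u, v), h⟩ with he
  have hu : e ∈ G.star u := by simp [mem_star, he]
  have hv : e ∈ G.star v := by simp [mem_star, he]
  have hN : G.lineGraph.neighborSet e = (G.star u \ {e}) ∪ (G.star v \ {e}) := by
    ext f
    simp only [mem_neighborSet, lineGraph_adj_iff_exists, Set.mem_union, Set.mem_sdiff,
      Set.mem_singleton_iff, mem_star, he, Sym2.mem_iff]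
    constructor
    · rintro ⟨h1, w, rfl | rfl, h3⟩
      · exact Or.inl ⟨h3, fun h => h1 h.symm⟩
      · exact Or.inr ⟨h3, fun h => h1 h.symm⟩
    · rintro (⟨h1, h2⟩ | ⟨h1, h2⟩)
      · exact ⟨fun h => h2 h.symm, u, Or.inl rfl, h1⟩
      · exact ⟨fun h => h2 h.symm, v, Or.inr rfl, h1⟩
  have hd : Disjoint (G.star u \ {e}) (G.star v \ {e}) := by
    rw [Set.disjoint_left]
    rintro f ⟨h1, h2⟩ ⟨h3, -⟩
    exact h2 (eq_of_mem_star h.ne h1 h3 hu hv)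
  have h1 := Set.ncard_sdiff_singleton_add_one hu
  have h2 := Set.ncard_sdiff_singleton_add_one hv
  rw [valency, hN, Set.ncard_union_eq hd, ← ncard_star, ← ncard_star]
  omega

lemma valency_pos_of_adj [Finite V] {u v : V} (h : G.Adj u v) : 0 < G.valency u :=
  (Set.ncard_pos).2 ⟨v, h⟩

lemma exists_adj_of_valency_pos {v : V} (h : 0 < G.valency v) : ∃ w, G.Adj v w :=
  Set.nonempty_of_ncard_ne_zero h.ne'

lemma Connected.lineGraph (hG : G.Connected) (hne : Nonempty G.edgeSet) :
    G.lineGraph.Connected := by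
  have key : ∀ {u v : V} (p : G.Walk u v) (e f : G.edgeSet), e ∈ G.star u → f ∈ G.star v →
      G.lineGraph.Reachable e f := by
    have same : ∀ (u : V) (e f : G.edgeSet), e ∈ G.star u → f ∈ G.star u →
        G.lineGraph.Reachable e f := by
      intro u e f he hf
      by_cases h : e = f
      · rw [h]
      · exact (lineGraph_adj_iff_exists.2 ⟨h, u, he, hf⟩).reachable
    intro u v p
    induction p with
    | nil => exact fun e f he hf => same _ e f he hf
    | @cons a b c hab p ih =>
      intro e f he hf
      have h1 : (⟨s(a, b), hab⟩ : G.edgeSet) ∈ G.star a := by simp [mem_star]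
      have h2 : (⟨s(a, b), hab⟩ : G.edgeSet) ∈ G.star b := by simp [mem_star]
      exact (same a _ _ he h1).trans (ih _ _ h2 hf)
  refine (connected_iff _).2 ⟨fun e f => ?_, hne⟩
  obtain ⟨⟨a, b⟩, hab⟩ := e
  obtain ⟨⟨c, d⟩, hcd⟩ := f
  obtain ⟨p⟩ := hG.preconnected a c
  exact key p _ _ (Sym2.mem_mk_left a b) (Sym2.mem_mk_left c d)

lemma Preconnected.forall_of_adj_closed (hG : G.Preconnected) {p : V → Prop} {v : V} (hv : p v)
    (hp : ∀ a b, G.Adj a b → p a → p b) (w : V) : p w := by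
  obtain ⟨q⟩ := hG v w
  induction q with
  | nil => exact hv
  | cons h q ih => exact ih (hp _ _ h hv)

lemma distinguishingNumber_le_two (f : V → Bool) (hf : G.Distinguishes f) :
    G.distinguishingNumber ≤ 2 := by
  refine iInf₂_le_of_le 2 ⟨fun v => if f v then 1 else 0, fun φ hφ => ?_⟩ (by norm_num)
  obtain ⟨v, hv⟩ := hf φ hφ
  refine ⟨v, fun h => hv ?_⟩
  cases h1 : f v <;> cases h2 : f (φ v) <;> simp_all

/-- All sufficiently late iterated line graphs have distinguishing number at most two. -/
def EventuallyTwoDistinguishable (G : SimpleGraph V) : Prop :=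
  ∃ K : ℕ, ∀ k : ℕ, K ≤ k → (G.iteratedLineGraph k).2.distinguishingNumber ≤ 2

lemma iteratedLineGraph_lineGraph (k : ℕ) :
    G.lineGraph.iteratedLineGraph k = G.iteratedLineGraph (k + 1) := by
  induction k with
  | zero => rfl
  | succ k ih => rw [iteratedLineGraph, ih]; rfl

lemma EventuallyTwoDistinguishable.of_lineGraph (h : G.lineGraph.EventuallyTwoDistinguishable) :
    G.EventuallyTwoDistinguishable := by
  obtain ⟨K, hK⟩ := h
  refine ⟨K + 1, fun k hk => ?_⟩
  obtain ⟨j, rfl⟩ : ∃ j, k = j + 1 := ⟨k - 1, by omega⟩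
  rw [← iteratedLineGraph_lineGraph]
  exact hK j (by omega)

lemma finite_iteratedLineGraph [Finite V] (k : ℕ) : Finite (G.iteratedLineGraph k).1 := by
  induction k with
  | zero => assumption
  | succ k ih => exact Subtype.finite

end SimpleGraph

/-! ### Minimum degree at least four: Whitney's theorem and the counting argument. -/

namespace SimpleGraph

variable {V : Type u} {G : SimpleGraph V}

/-- The images of the edges at `v` meet pairwise, so they form part of a star or of a triangle; a
triangle is too small to hold four edges. -/
lemma Iso.lineGraph_image_star_subset [Finite V] (hG : ∀ v, 4 ≤ G.valency v)
    (φ : G.lineGraph ≃g G.lineGraph) (v : V) : ∃ w, φ '' G.star v ⊆ G.star w := by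
  have hmeet : ∀ e ∈ G.star v, ∀ f ∈ G.star v, ∃ x, φ e ∈ G.star x ∧ φ f ∈ G.star x := by
    intro e he f hf
    by_cases h : e = f
    · subst h
      obtain ⟨⟨a, b⟩, hab⟩ := φ e
      exact ⟨a, Sym2.mem_mk_left a b, Sym2.mem_mk_left a b⟩
    · exact (lineGraph_adj_iff_exists.1
        (φ.map_rel_iff.2 (lineGraph_adj_iff_exists.2 ⟨h, v, he, hf⟩))).2
  have h4 : 4 ≤ (G.star v).ncard := (hG v).trans_eq (ncard_star v).symm
  obtain ⟨e₁, he₁, e₂, he₂, h12⟩ := (Set.one_lt_ncard).1 (by omega : 1 < (G.star v).ncard)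
  obtain ⟨a, ha₁, ha₂⟩ := hmeet e₁ he₁ e₂ he₂
  obtain ⟨b, hb⟩ : ∃ b, (φ e₁ : Sym2 V) = s(a, b) := ⟨_, (Sym2.other_spec ha₁).symm⟩
  obtain ⟨c, hc⟩ : ∃ c, (φ e₂ : Sym2 V) = s(a, c) := ⟨_, (Sym2.other_spec ha₂).symm⟩
  have hbc : b ≠ c := by
    rintro rfl
    exact h12 (φ.injective (Subtype.ext (hb.trans hc.symm)))
  have hab : a ≠ b := by
    have := (φ e₁).2
    rw [hb] at this
    exact G.ne_of_adj this
  have hac : a ≠ c := by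
    have := (φ e₂).2
    rw [hc] at this
    exact G.ne_of_adj this
  have third : ∀ e ∈ G.star v, φ e ∈ G.star a ∨ (φ e : Sym2 V) = s(b, c) := by
    intro e he
    obtain ⟨x, hx, hx₁⟩ := hmeet e he e₁ he₁
    obtain ⟨y, hy, hy₂⟩ := hmeet e he e₂ he₂
    rw [mem_star] at *
    rw [hb, Sym2.mem_iff] at hx₁
    rw [hc, Sym2.mem_iff] at hy₂
    rcases hx₁ with rfl | rfl
    · exact Or.inl hx
    rcases hy₂ with rfl | rfl
    · exact Or.inl hy
    exact Or.inr ((Sym2.mem_and_mem_iff hbc).1 ⟨hx, hy⟩)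
  refine ⟨a, ?_⟩
  rintro _ ⟨f, hf, rfl⟩
  by_contra hfa
  have hfbc := (third f hf).resolve_left hfa
  -- The images of `e₁`, `e₂`, `f` are the sides `ab`, `ac`, `bc` of a triangle, and any edge
  -- meeting all three sides is one of them.
  have hsub : G.star v ⊆ {e₁, e₂, f} := by
    intro g hg
    rcases third g hg with hga | hgbc
    · obtain ⟨x, hx, hx'⟩ := hmeet g hg f hf
      rw [mem_star, hfbc, Sym2.mem_iff] at hx'
      rcases hx' with rfl | rfl
      · left
        exact φ.injective (Subtype.ext (((Sym2.mem_and_mem_iff hab).1 ⟨hga, hx⟩).trans hb.symm))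
      · right; left
        exact φ.injective (Subtype.ext (((Sym2.mem_and_mem_iff hac).1 ⟨hga, hx⟩).trans hc.symm))
    · right; right
      exact φ.injective (Subtype.ext (hgbc.trans hfbc.symm))
  have h3 : ({e₁, e₂, f} : Set G.edgeSet).ncard ≤ 3 := by
    refine (Set.ncard_insert_le _ _).trans ?_
    have := Set.ncard_insert_le e₂ {f}
    rw [Set.ncard_singleton] at this
    omega
  have := Set.ncard_le_ncard hsub
  omega

lemma star_subset_star_iff [Finite V] {v w : V} (hv : 2 ≤ G.valency v) :
    G.star v ⊆ G.star w ↔ v = w := by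
  refine ⟨fun h => ?_, fun h => h ▸ subset_rfl⟩
  by_contra hne
  obtain ⟨e₁, he₁, e₂, he₂, h12⟩ := (Set.one_lt_ncard).1
    (by rw [ncard_star]; omega : 1 < (G.star v).ncard)
  exact h12 (eq_of_mem_star hne he₁ (h he₁) he₂ (h he₂))

lemma Iso.exists_lineGraph_image_star_eq [Finite V] (hG : ∀ v, 4 ≤ G.valency v)
    (φ : G.lineGraph ≃g G.lineGraph) (v : V) : ∃ w, φ '' G.star v = G.star w := by
  obtain ⟨w, hw⟩ := φ.lineGraph_image_star_subset hG v
  obtain ⟨x, hx⟩ := φ.symm.lineGraph_image_star_subset hG w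
  have hvx : v = x := by
    have h2 : 2 ≤ G.valency v := (by norm_num : 2 ≤ 4).trans (hG v)
    rw [← star_subset_star_iff h2]
    refine fun e he => hx ⟨φ e, hw ⟨e, he, rfl⟩, φ.symm_apply_apply e⟩
  subst hvx
  refine ⟨w, hw.antisymm fun e he => ⟨φ.symm e, hx ⟨e, he, rfl⟩, φ.apply_symm_apply e⟩⟩

/-- **Whitney's theorem** for graphs with minimum degree at least four: the automorphisms of the
line graph are induced by automorphisms of the graph. -/
theorem exists_iso_of_lineGraph_iso [Finite V] (hG : ∀ v, 4 ≤ G.valency v)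
    (φ : G.lineGraph ≃g G.lineGraph) :
    ∃ ψ : G ≃g G, ∀ e : G.edgeSet, (φ e : Sym2 V) = (e : Sym2 V).map ψ := by
  choose ψ hψ using φ.exists_lineGraph_image_star_eq hG
  have hinj : Function.Injective ψ := by
    intro v w h
    have h1 := (hψ v).trans ((congrArg G.star h).trans (hψ w).symm)
    have h2 : 2 ≤ G.valency v := (by norm_num : 2 ≤ 4).trans (hG v)
    exact (star_subset_star_iff h2).1
      (Set.image_injective.2 φ.injective h1).subset
  have hmem : ∀ {e : G.edgeSet} {v : V}, v ∈ (e : Sym2 V) → ψ v ∈ (φ e : Sym2 V) := by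
    intro e v h
    have : φ e ∈ G.star (ψ v) := hψ v ▸ ⟨e, h, rfl⟩
    exact this
  have hmap : ∀ e : G.edgeSet, (φ e : Sym2 V) = (e : Sym2 V).map ψ := by
    rintro ⟨⟨a, b⟩, hab⟩
    have hab' : G.Adj a b := hab
    exact (Sym2.mem_and_mem_iff (hinj.ne hab'.ne)).1
      ⟨hmem (Sym2.mem_mk_left a b), hmem (Sym2.mem_mk_right a b)⟩
  have hbij := Finite.injective_iff_bijective.1 hinj
  refine ⟨⟨Equiv.ofBijective ψ hbij, ?_⟩, hmap⟩
  intro a b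
  simp only [Equiv.ofBijective_apply]
  constructor
  · intro h
    have hne : a ≠ b := fun hab => h.ne (congrArg ψ hab)
    set e : G.edgeSet := ⟨s(ψ a, ψ b), h⟩ with he
    have ha : e ∈ φ '' G.star a := (hψ a).symm ▸ Sym2.mem_mk_left _ _
    have hb : e ∈ φ '' G.star b := (hψ b).symm ▸ Sym2.mem_mk_right _ _
    obtain ⟨f, hf, hfe⟩ := ha
    obtain ⟨g, hg, hge⟩ := hb
    obtain rfl : f = g := φ.injective (hfe.trans hge.symm)
    have := f.2
    rwa [(Sym2.mem_and_mem_iff hne).1 ⟨hf, hg⟩] at this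
  · intro h
    have := (φ ⟨s(a, b), h⟩).2
    rw [hmap] at this
    exact this

lemma finite_iso [Finite V] : Finite (G ≃g G) :=
  Finite.of_injective (fun φ : G ≃g G => (φ : V → V)) DFunLike.coe_injective

lemma card_iso_lineGraph_le [Finite V] (hG : ∀ v, 4 ≤ G.valency v) :
    Nat.card (G.lineGraph ≃g G.lineGraph) ≤ Nat.card (G ≃g G) := by
  have := finite_iso (G := G)
  choose Ψ hΨ using exists_iso_of_lineGraph_iso hG
  refine Nat.card_le_card_of_injective Ψ fun φ φ' h => ?_
  ext e : 1
  exact Subtype.ext (by rw [hΨ, hΨ, h])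

/-- If every nontrivial automorphism moves some set of at least `m` vertices off itself and there
are fewer than `2 ^ m` automorphisms, then two colours suffice. -/
lemma distinguishingNumber_le_two_of_card_iso_lt [Finite V] {m : ℕ}
    (hm : ∀ φ : G ≃g G, φ ≠ Iso.refl →
      ∃ S : Set V, m ≤ S.ncard ∧ ∀ v ∈ S, φ v ∉ S)
    (hcard : Nat.card (G ≃g G) < 2 ^ m) : G.distinguishingNumber ≤ 2 := by
  classical
  have := Fintype.ofFinite V
  have := finite_iso (G := G)
  have := Fintype.ofFinite (G ≃g G)
  let B : (G ≃g G) → Finset (V → Bool) := fun φ =>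
    if φ = Iso.refl then ∅ else Finset.univ.filter fun f => ∀ v, f v = f (φ v)
  have hB : ∀ φ, (B φ).card * 2 ^ m ≤ 2 ^ Fintype.card V := by
    intro φ
    by_cases hφ : φ = Iso.refl
    · simp [B, hφ]
    obtain ⟨S, hS, hS'⟩ := hm φ hφ
    -- A colouring preserved by `φ` is determined by its values off `S`, since `φ` sends `S` into
    -- the complement.
    have hle : (B φ).card ≤ Fintype.card ((Sᶜ : Set V) → Bool) := by
      rw [← Finset.card_univ]
      refine Finset.card_le_card_of_injOn (fun f v => f v) (fun _ _ => Finset.mem_univ _) ?_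
      intro f hf g hg hfg
      simp only [B, hφ, if_false, Finset.coe_filter, Finset.mem_univ, true_and,
        Set.mem_ofPred_eq] at hf hg
      have hc : ∀ v, v ∉ S → f v = g v := fun v hv => congrFun hfg ⟨v, hv⟩
      funext v
      by_cases hv : v ∈ S
      · rw [hf v, hg v, hc _ (hS' v hv)]
      · exact hc v hv
    rw [Fintype.card_fun, Fintype.card_bool] at hle
    have hsum : S.ncard + Fintype.card (Sᶜ : Set V) = Fintype.card V := by
      rw [← Nat.card_eq_fintype_card, ← Nat.card_eq_fintype_card]
      exact Set.ncard_add_ncard_compl S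
    calc (B φ).card * 2 ^ m ≤ 2 ^ Fintype.card (Sᶜ : Set V) * 2 ^ S.ncard :=
          Nat.mul_le_mul hle (Nat.pow_le_pow_right (by norm_num) hS)
      _ = 2 ^ Fintype.card V := by rw [← pow_add, add_comm, hsum]
  have hU : (Finset.univ.biUnion B).card < Fintype.card (V → Bool) := by
    rw [Fintype.card_fun, Fintype.card_bool]
    have h1 : (Finset.univ.biUnion B).card * 2 ^ m ≤ Nat.card (G ≃g G) * 2 ^ Fintype.card V := by
      calc (Finset.univ.biUnion B).card * 2 ^ m ≤ (∑ φ, (B φ).card) * 2 ^ m :=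
            Nat.mul_le_mul_right _ Finset.card_biUnion_le
        _ = ∑ φ, (B φ).card * 2 ^ m := Finset.sum_mul ..
        _ ≤ ∑ _φ : G ≃g G, 2 ^ Fintype.card V := Finset.sum_le_sum fun φ _ => hB φ
        _ = _ := by simp [Nat.card_eq_fintype_card]
    have h2 : Nat.card (G ≃g G) * 2 ^ Fintype.card V < 2 ^ m * 2 ^ Fintype.card V :=
      Nat.mul_lt_mul_of_pos_right hcard (by positivity)
    rw [mul_comm (2 ^ m)] at h2
    exact lt_of_mul_lt_mul_right (h1.trans_lt h2) (by positivity)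
  obtain ⟨f, hf⟩ : ∃ f, f ∉ Finset.univ.biUnion B := by
    by_contra! h
    exact hU.ne (by rw [Finset.eq_univ_iff_forall.2 h, Finset.card_univ])
  refine distinguishingNumber_le_two f fun φ hφ => ?_
  by_contra! h
  exact hf (Finset.mem_biUnion.2 ⟨φ, Finset.mem_univ _, by simpa [B, hφ] using h⟩)

/-- Let `ψ` induce `φ` and move `v`. For an edge `e` at `v`, the image `φ e` is again at `v` only if
`e` contains `ψ.symm v`. Discarding the edges from `v` to `ψ v` and `ψ.symm v` costs at most two. -/
lemma exists_moved_set_lineGraph [Finite V] {m : ℕ} (hG : ∀ v, 4 ≤ G.valency v)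
    (hm : ∀ v, m + 2 ≤ G.valency v) (φ : G.lineGraph ≃g G.lineGraph) (hφ : φ ≠ Iso.refl) :
    ∃ S : Set G.edgeSet, m ≤ S.ncard ∧ ∀ e ∈ S, φ e ∉ S := by
  obtain ⟨ψ, hψ⟩ := exists_iso_of_lineGraph_iso hG φ
  obtain ⟨v, hv⟩ : ∃ v, ψ v ≠ v := by
    by_contra! h
    refine hφ (DFunLike.ext _ _ fun e => Subtype.ext ?_)
    rw [hψ, show (ψ : V → V) = id from funext h, Sym2.map_id]
    rfl
  refine ⟨G.star v \ (G.star (ψ v) ∪ G.star (ψ.symm v)), ?_, ?_⟩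
  · have hone : ∀ w, w ≠ v → (G.star v ∩ G.star w).ncard ≤ 1 := by
      intro w hw
      refine (Set.ncard_le_one).2 fun e he f hf => ?_
      exact eq_of_mem_star hw.symm he.1 he.2 hf.1 hf.2
    have hv' : ψ.symm v ≠ v := fun h => hv (by rw [← h, ψ.apply_symm_apply, h])
    have h1 := hone _ hv
    have h2 := hone _ hv'
    have h3 := Set.ncard_union_le (G.star v ∩ G.star (ψ v)) (G.star v ∩ G.star (ψ.symm v))
    have h4 : (G.star v).ncard ≤ (G.star v \ (G.star (ψ v) ∪ G.star (ψ.symm v))).ncard +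
        (G.star v ∩ G.star (ψ v) ∪ G.star v ∩ G.star (ψ.symm v)).ncard := by
      refine (Set.ncard_le_ncard ?_).trans (Set.ncard_union_le _ _)
      rw [← Set.inter_union_distrib_left, Set.sdiff_union_inter]
    have h5 := hm v
    rw [ncard_star] at h4
    omega
  · rintro e ⟨hev, hne⟩ ⟨hv₁, -⟩
    rw [mem_star, hψ, Sym2.mem_map] at hv₁
    obtain ⟨w, hw, hwv⟩ := hv₁
    refine hne (Or.inr ?_)
    rw [mem_star, ← hwv, ψ.symm_apply_apply]
    exact hw

lemma le_valency_lineGraph [Finite V] {m : ℕ} (h : ∀ v, m + 1 ≤ G.valency v) (e : G.edgeSet) :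
    2 * m ≤ G.lineGraph.valency e := by
  obtain ⟨⟨a, b⟩, hab⟩ := e
  have := valency_lineGraph (G := G) (u := a) (v := b) hab
  have h1 := h a
  have h2 := h b
  change 2 * m ≤ G.lineGraph.valency ⟨s(a, b), hab⟩
  omega

lemma eventuallyTwoDistinguishable_of_four_le [Finite V] (hG : ∀ v, 4 ≤ G.valency v) :
    G.EventuallyTwoDistinguishable := by
  have key : ∀ k, (∀ v, k + 4 ≤ (G.iteratedLineGraph k).2.valency v) ∧
      Nat.card ((G.iteratedLineGraph k).2 ≃g (G.iteratedLineGraph k).2) ≤ Nat.card (G ≃g G) := by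
    intro k
    induction k with
    | zero => exact ⟨fun v => (hG v :), le_rfl⟩
    | succ k ih =>
      have := finite_iteratedLineGraph (G := G) k
      refine ⟨fun e => ?_, (card_iso_lineGraph_le fun v => ?_).trans ih.2⟩
      · have := le_valency_lineGraph (G := (G.iteratedLineGraph k).2) (m := k + 3) ih.1 e
        change k + 1 + 4 ≤ (G.iteratedLineGraph k).2.lineGraph.valency e
        omega
      · have := ih.1 v
        omega
  -- With `k = j + 1`, the `j`-th iterate has minimum degree at least `j + 4`, so its line graph has
  -- moved sets of size `j + 2`, and `2 ^ (j + 2)` exceeds the order of the group.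
  refine ⟨Nat.card (G ≃g G) + 1, fun k hk => ?_⟩
  obtain ⟨j, rfl⟩ : ∃ j, k = j + 1 := ⟨k - 1, by omega⟩
  have := finite_iteratedLineGraph (G := G) j
  have hj := (key j).1
  refine distinguishingNumber_le_two_of_card_iso_lt (G := (G.iteratedLineGraph j).2.lineGraph)
    (m := j + 2) (exists_moved_set_lineGraph (fun v => ?_) (fun v => ?_)) ?_
  · have := hj v
    omega
  · have := hj v
    omega
  · calc _ ≤ Nat.card (G ≃g G) := (key (j + 1)).2
      _ ≤ j := by omega
      _ < 2 ^ j := Nat.lt_two_pow_self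
      _ ≤ 2 ^ (j + 2) := Nat.pow_le_pow_right (by norm_num) (by omega)

lemma eventuallyTwoDistinguishable_of_three_le [Finite V] (hG : ∀ v, 3 ≤ G.valency v) :
    G.EventuallyTwoDistinguishable :=
  .of_lineGraph (eventuallyTwoDistinguishable_of_four_le (le_valency_lineGraph hG))

end SimpleGraph

/-! ### Eliminating the vertices of degree at most two. -/

namespace SimpleGraph

variable {V : Type u} {G : SimpleGraph V}

/-- The vertices of degree at most two. -/
def lowVerts (G : SimpleGraph V) : Set V := {v | G.valency v ≤ 2}

/-- The edges of `G` which have degree at most two in the line graph. -/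
def lowEdgeGraph (G : SimpleGraph V) : SimpleGraph V where
  Adj v w := G.Adj v w ∧ G.valency v + G.valency w ≤ 4
  symm.symm _ _ h := ⟨h.1.symm, by omega⟩
  loopless := ⟨fun _ h => h.1.ne rfl⟩

lemma lowEdgeGraph_adj {v w : V} :
    G.lowEdgeGraph.Adj v w ↔ G.Adj v w ∧ G.valency v + G.valency w ≤ 4 := Iff.rfl

lemma ncard_lowVerts_lineGraph [Finite V] :
    G.lineGraph.lowVerts.ncard = G.lowEdgeGraph.edgeSet.ncard := by
  rw [← Set.ncard_image_of_injective G.lineGraph.lowVerts Subtype.val_injective]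
  congr 1
  ext e
  induction e with | _ a b
  simp only [Set.mem_image, Subtype.exists, exists_and_right, exists_eq_right, mem_edgeSet,
    lowEdgeGraph_adj]
  refine exists_prop.symm.trans ?_ |>.symm
  refine exists_congr fun hab => ?_
  have := valency_lineGraph hab
  simp only [lowVerts, Set.mem_ofPred_eq]
  omega

lemma eq_of_valency_le_one [Finite V] {v a b : V} (hv : G.valency v ≤ 1) (ha : G.Adj v a)
    (hb : G.Adj v b) : a = b :=
  (Set.ncard_le_one).1 hv a ha b hb

open Classical in
-- Every low edge has a low end. If the other end is not low, its half of the count is transferred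
-- to the low end.
lemma two_mul_ncard_lowVerts_lineGraph [Fintype V] :
    2 * G.lineGraph.lowVerts.ncard = ∑ v with v ∈ G.lowVerts,
      ((Finset.univ.filter fun w => G.lowEdgeGraph.Adj v w).card +
        (Finset.univ.filter fun w => w ∉ G.lowVerts ∧ G.lowEdgeGraph.Adj v w).card) := by
  rw [ncard_lowVerts_lineGraph, Set.ncard_eq_toFinset_card', ← edgeFinset,
    ← sum_degrees_eq_twice_card_edges, Finset.sum_add_distrib,
    ← Finset.sum_filter_add_sum_filter_not Finset.univ (· ∈ G.lowVerts)]
  congr 1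
  · refine Finset.sum_congr rfl fun v _ => ?_
    rw [← card_neighborFinset_eq_degree, neighborFinset_eq_filter]
  · have h1 := Finset.sum_card_bipartiteAbove_eq_sum_card_bipartiteBelow
      (s := Finset.univ.filter (· ∉ G.lowVerts)) (t := Finset.univ.filter (· ∈ G.lowVerts))
      G.lowEdgeGraph.Adj
    refine Eq.trans (Finset.sum_congr rfl fun v hv => ?_) (h1.trans ?_)
    · rw [← card_neighborFinset_eq_degree, neighborFinset_eq_filter, Finset.bipartiteAbove,
        Finset.filter_filter]
      congr 1
      refine Finset.filter_congr fun w _ => ⟨fun h => ⟨?_, h⟩, fun h => h.2⟩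
      have hv' : ¬ G.valency v ≤ 2 := (Finset.mem_filter.1 hv).2
      have := (lowEdgeGraph_adj.1 h).2
      change G.valency w ≤ 2
      omega
    · refine Finset.sum_congr rfl fun v _ => ?_
      rw [Finset.bipartiteBelow, Finset.filter_filter]
      congr 1
      exact Finset.filter_congr fun w _ => by rw [G.lowEdgeGraph.adj_comm]

/-- In the double count each low vertex receives at most 2: one of degree 2 has no low edge to a
high vertex, and a leaf has a single edge, counted at most twice. Either hypothesis makes the
contribution of `v` at most 1. -/
lemma ncard_lowVerts_lineGraph_lt [Finite V] {v w : V} (hvw : G.Adj v w)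
    (h : G.valency v = 2 ∧ 3 ≤ G.valency w ∨ G.valency v = 1 ∧ G.valency w ≤ 2) :
    G.lineGraph.lowVerts.ncard < G.lowVerts.ncard := by
  classical
  have := Fintype.ofFinite V
  have hA : ∀ x, (Finset.univ.filter fun y => G.lowEdgeGraph.Adj x y).card ≤ G.valency x := by
    intro x
    rw [valency_eq_degree, ← card_neighborFinset_eq_degree]
    refine Finset.card_le_card fun y hy => ?_
    rw [mem_neighborFinset]
    exact (Finset.mem_filter.1 hy).2.1
  have hBA : ∀ x, (Finset.univ.filter fun y => y ∉ G.lowVerts ∧ G.lowEdgeGraph.Adj x y).card ≤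
      (Finset.univ.filter fun y => G.lowEdgeGraph.Adj x y).card := fun x =>
    Finset.card_le_card (Finset.monotone_filter_right _ fun y _ hy => hy.2)
  have hB : ∀ x, G.valency x = 2 →
      (Finset.univ.filter fun y => y ∉ G.lowVerts ∧ G.lowEdgeGraph.Adj x y).card = 0 := by
    intro x hx
    rw [Finset.card_eq_zero, Finset.filter_eq_empty_iff]
    rintro y - ⟨hy, -, hxy⟩
    exact hy (by change G.valency y ≤ 2; omega)
  have hlt : 2 * G.lineGraph.lowVerts.ncard < ∑ v with v ∈ G.lowVerts, 2 := by
    rw [two_mul_ncard_lowVerts_lineGraph]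
    refine Finset.sum_lt_sum (fun x hx => ?_) ⟨v, ?_, ?_⟩
    · have hx' : G.valency x ≤ 2 := (Finset.mem_filter.1 hx).2
      have h1 := hA x
      have h2 := hBA x
      rcases hx'.lt_or_eq with h3 | h3
      · omega
      · have := hB x h3
        omega
    · refine Finset.mem_filter.2 ⟨Finset.mem_univ _, ?_⟩
      change G.valency v ≤ 2
      omega
    · rcases h with ⟨h2, h3⟩ | ⟨h1, h2⟩
      · have hlt : (Finset.univ.filter fun y => G.lowEdgeGraph.Adj v y).card < G.valency v := by
          rw [valency_eq_degree, ← card_neighborFinset_eq_degree]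
          refine Finset.card_lt_card ⟨fun y hy => ?_, fun hsub => ?_⟩
          · rw [mem_neighborFinset]
            exact (Finset.mem_filter.1 hy).2.1
          · have := hsub ((mem_neighborFinset ..).2 hvw)
            have := (Finset.mem_filter.1 this).2.2
            omega
        have := hB v h2
        omega
      · have hz : (Finset.univ.filter fun y =>
            y ∉ G.lowVerts ∧ G.lowEdgeGraph.Adj v y).card = 0 := by
          rw [Finset.card_eq_zero, Finset.filter_eq_empty_iff]
          rintro y - ⟨hy, hvy, -⟩
          exact hy (eq_of_valency_le_one h1.le hvw hvy ▸ h2)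
        have := hA v
        omega
  rw [Finset.sum_const, smul_eq_mul] at hlt
  rw [Set.ncard_eq_toFinset_card', Set.toFinset_card, Fintype.card_subtype]
  simp only [Set.ncard_eq_toFinset_card', Set.toFinset_card, Fintype.card_subtype] at hlt ⊢
  omega

/-- A connected graph in which some edge has degree at least three in the line graph. The connected
finite graphs without this property are the paths, the cycles and the claw. -/
structure IsProlific (G : SimpleGraph V) : Prop where
  connected : G.Connected
  exists_adj : ∃ u v, G.Adj u v ∧ 5 ≤ G.valency u + G.valency v

lemma IsProlific.exists_three_le (hG : G.IsProlific) :
    ∃ u v, G.Adj u v ∧ 5 ≤ G.valency u + G.valency v ∧ 3 ≤ G.valency v := by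
  obtain ⟨u, v, huv, h⟩ := hG.exists_adj
  by_cases hv : 3 ≤ G.valency v
  · exact ⟨u, v, huv, h, hv⟩
  · exact ⟨v, u, huv.symm, by omega, by omega⟩

lemma IsProlific.lineGraph [Finite V] (hG : G.IsProlific) : G.lineGraph.IsProlific := by
  obtain ⟨u, v, huv, h5, h3⟩ := hG.exists_three_le
  refine ⟨hG.connected.lineGraph ⟨⟨s(u, v), huv⟩⟩, ?_⟩
  obtain ⟨x, hx, hxu⟩ := Set.exists_ne_of_one_lt_ncard
    (by change 1 < G.valency v; omega : 1 < (G.neighborSet v).ncard) u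
  have hvx : G.Adj v x := hx
  refine ⟨⟨s(u, v), huv⟩, ⟨s(v, x), hvx⟩, lineGraph_adj_iff_exists.2 ⟨fun h => ?_, v, ?_, ?_⟩, ?_⟩
  · have h' : s(u, v) = s(v, x) := congrArg Subtype.val h
    rw [Sym2.eq_swap, Sym2.congr_right] at h'
    exact hxu h'.symm
  · exact Sym2.mem_mk_right u v
  · exact Sym2.mem_mk_left v x
  · have h1 := valency_lineGraph huv
    have h2 := valency_lineGraph hvx
    have h3 := valency_pos_of_adj hvx.symm
    omega

/-- The number of low vertices drops as long as a low vertex has a high neighbour. When none does,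
connectedness and the existence of a high vertex leave no low vertices. -/
lemma IsProlific.eventuallyTwoDistinguishable_of_two_le (n : ℕ) :
    ∀ {V : Type u} [Finite V] {G : SimpleGraph V}, G.IsProlific → (∀ v, 2 ≤ G.valency v) →
      G.lowVerts.ncard ≤ n → G.EventuallyTwoDistinguishable := by
  induction n with
  | zero =>
    intro V _ G _ _ hn
    refine eventuallyTwoDistinguishable_of_three_le fun v => ?_
    have h0 := (Set.ncard_eq_zero).1 (Nat.le_zero.1 hn)
    by_contra! hv
    have : v ∈ G.lowVerts := Nat.le_of_lt_succ hv
    rw [h0] at this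
    exact this
  | succ n ih =>
    intro V _ G hG h2 hn
    by_cases hlow : ∃ v w, G.Adj v w ∧ G.valency v ≤ 2 ∧ 3 ≤ G.valency w
    · obtain ⟨v, w, hvw, hv, hw⟩ := hlow
      have := ncard_lowVerts_lineGraph_lt hvw (Or.inl ⟨hv.antisymm (h2 v), hw⟩)
      exact .of_lineGraph (ih hG.lineGraph (le_valency_lineGraph h2) (by omega))
    · push Not at hlow
      refine eventuallyTwoDistinguishable_of_three_le fun v => ?_
      by_contra! hv
      obtain ⟨-, w, -, -, hw⟩ := hG.exists_three_le
      have := hG.connected.preconnected.forall_of_adj_closed (p := fun v => G.valency v ≤ 2)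
        (Nat.le_of_lt_succ hv) (fun a b hab ha => Nat.le_of_lt_succ (hlow a b hab ha)) w
      omega

lemma IsProlific.eventuallyTwoDistinguishable_of_ncard_le (n : ℕ) :
    ∀ {V : Type u} [Finite V] {G : SimpleGraph V}, G.IsProlific →
      G.lowVerts.ncard < n → G.EventuallyTwoDistinguishable := by
  induction n with
  | zero => exact fun _ h => absurd h (Nat.not_lt_zero _)
  | succ n ih =>
    intro V _ G hG hn
    by_cases hlow : ∃ v w, G.Adj v w ∧ G.valency v = 1 ∧ G.valency w ≤ 2
    · obtain ⟨v, w, hvw, hv, hw⟩ := hlow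
      have := ncard_lowVerts_lineGraph_lt hvw (Or.inr ⟨hv, hw⟩)
      exact .of_lineGraph (ih hG.lineGraph (by omega))
    · push Not at hlow
      -- Every leaf now hangs on a vertex of degree at least 3, so every edge has degree at least 2
      -- in the line graph.
      refine .of_lineGraph (eventuallyTwoDistinguishable_of_two_le _ hG.lineGraph ?_ le_rfl)
      rintro ⟨⟨a, b⟩, hab⟩
      have hab' : G.Adj a b := hab
      change 2 ≤ G.lineGraph.valency ⟨s(a, b), hab'⟩
      have h1 := valency_lineGraph hab'
      have h2 := valency_pos_of_adj hab'
      have h3 := valency_pos_of_adj hab'.symm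
      have h4 := hlow a b hab'
      have h5 := hlow b a hab'.symm
      omega

theorem IsProlific.eventuallyTwoDistinguishable [Finite V] (hG : G.IsProlific) :
    G.EventuallyTwoDistinguishable :=
  eventuallyTwoDistinguishable_of_ncard_le _ hG (Nat.lt_succ_self _)

/-- If all edges had degree sum at most 4, `v` would have exactly three neighbours, all leaves, and
by connectedness the graph would be the claw. -/
lemma Connected.isProlific_of_three_le [Finite V] (hG : G.Connected) {v : V}
    (hv : 3 ≤ G.valency v)
    (hclaw : IsEmpty (G ≃g completeBipartiteGraph (Fin 1) (Fin 3))) : G.IsProlific := by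
  refine ⟨hG, ?_⟩
  by_contra! hlt
  have hleaf : ∀ w, G.Adj v w → G.valency v = 3 ∧ G.valency w = 1 := by
    intro w hw
    have h1 := hlt v w hw
    have h2 := valency_pos_of_adj hw.symm
    omega
  have huniq : ∀ w x, G.Adj v w → G.Adj w x → x = v := fun w x hw hx =>
    eq_of_valency_le_one (hleaf w hw).2.le hx hw.symm
  obtain ⟨w, hw⟩ := exists_adj_of_valency_pos (by omega : 0 < G.valency v)
  have hcard : Nat.card (G.neighborSet v) = 3 := (hleaf w hw).1
  let e : Fin 3 ≃ G.neighborSet v := (Finite.equivFinOfCardEq hcard).symm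
  let g : Fin 1 ⊕ Fin 3 → V := Sum.elim (fun _ => v) fun i => e i
  have hadj : ∀ i, G.Adj v (e i) := fun i => (e i).2
  have hinj : Function.Injective g := by
    rintro (i | i) (j | j) h
    · rw [Subsingleton.elim i j]
    · exact absurd h (hadj j).ne
    · exact absurd h.symm (hadj i).ne
    · rw [e.injective (Subtype.ext h)]
  have hsurj : Function.Surjective g := by
    refine hG.preconnected.forall_of_adj_closed (p := fun x => ∃ i, g i = x) ⟨Sum.inl 0, rfl⟩ ?_
    rintro _ b hab ⟨i | i, rfl⟩
    · exact ⟨Sum.inr (e.symm ⟨b, hab⟩), by simp [g]⟩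
    · exact ⟨Sum.inl 0, (huniq _ _ (hadj i) hab).symm⟩
  have hiff : ∀ x y, G.Adj (g x) (g y) ↔ (completeBipartiteGraph (Fin 1) (Fin 3)).Adj x y := by
    rintro (i | i) (j | j)
    · simp [g]
    · simpa [g] using hadj j
    · simpa [g] using (hadj i).symm
    · simpa [g] using fun h => (hadj j).ne (huniq _ _ (hadj i) h).symm
  exact hclaw.elim (Iso.symm ⟨Equiv.ofBijective g ⟨hinj, hsurj⟩, hiff _ _⟩)

end SimpleGraph

/-! ### Paths and cycles. -/

namespace SimpleGraph

variable {V : Type u} {G : SimpleGraph V}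

lemma sum_valency [Fintype V] : ∑ v, G.valency v = 2 * Nat.card G.edgeSet := by
  classical
  simp only [valency_eq_degree, sum_degrees_eq_twice_card_edges, Nat.card_eq_fintype_card,
    edgeFinset_card]

lemma valency_lineGraph_le_two [Finite V] (hG : ∀ v, G.valency v ≤ 2) (e : G.edgeSet) :
    G.lineGraph.valency e ≤ 2 := by
  obtain ⟨⟨a, b⟩, hab⟩ := e
  change G.lineGraph.valency ⟨s(a, b), hab⟩ ≤ 2
  have h := valency_lineGraph (G := G) (u := a) (v := b) hab
  have ha := hG a
  have hb := hG b
  omega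

lemma isEmpty_iteratedLineGraph [IsEmpty V] (k : ℕ) : IsEmpty (G.iteratedLineGraph k).1 := by
  induction k with
  | zero => assumption
  | succ k ih => exact ⟨fun e => by obtain ⟨⟨a, -⟩, -⟩ := e; exact isEmptyElim a⟩

lemma eventuallyTwoDistinguishable_of_isEmpty [IsEmpty V] : G.EventuallyTwoDistinguishable := by
  refine ⟨0, fun k _ => ?_⟩
  have := isEmpty_iteratedLineGraph (G := G) k
  exact distinguishingNumber_le_two isEmptyElim fun φ hφ =>
    absurd (DFunLike.ext _ _ isEmptyElim) hφ

/-- Paths have empty late iterated line graphs. -/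
lemma eventuallyTwoDistinguishable_of_path (n : ℕ) :
    ∀ {V : Type u} [Finite V] {G : SimpleGraph V}, G.Connected → (∀ v, G.valency v ≤ 2) →
      (∃ v, G.valency v ≤ 1) → Nat.card V < n → G.EventuallyTwoDistinguishable := by
  induction n with
  | zero => exact fun _ _ _ h => absurd h (Nat.not_lt_zero _)
  | succ n ih =>
    intro V _ G hG h2 ⟨v, hv⟩ hn
    refine .of_lineGraph ?_
    cases isEmpty_or_nonempty G.edgeSet with
    | inl he => exact eventuallyTwoDistinguishable_of_isEmpty
    | inr he =>
      refine ih (hG.lineGraph he) (valency_lineGraph_le_two h2) ?_ ?_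
      -- Otherwise every edge would join two vertices of degree 2, and connectedness would carry
      -- degree 2 to `v`.
      · by_contra! hE
        obtain ⟨⟨⟨a, b⟩, hab⟩⟩ := he
        have hclosed : ∀ x y, G.Adj x y → G.valency x = 2 ∧ G.valency y = 2 := by
          intro x y hxy
          have h1 := hE ⟨s(x, y), hxy⟩
          have h3 := valency_lineGraph hxy
          have hx := h2 x
          have hy := h2 y
          omega
        have := hG.preconnected.forall_of_adj_closed (p := fun x => G.valency x = 2)
          (hclosed a b hab).1 (fun x y hxy _ => (hclosed x y hxy).2) v
        omega
      -- The degree sum is below twice the number of vertices, so the line graph has fewer vertices.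
      · have := Fintype.ofFinite V
        have hlt : ∑ x, G.valency x < ∑ _x : V, 2 :=
          Finset.sum_lt_sum (fun x _ => h2 x) ⟨v, Finset.mem_univ _, by omega⟩
        rw [sum_valency, Finset.sum_const, Finset.card_univ, smul_eq_mul,
          ← Nat.card_eq_fintype_card] at hlt
        omega

lemma card_edgeSet_of_valency_eq_two [Finite V] (h2 : ∀ v, G.valency v = 2) :
    Nat.card G.edgeSet = Nat.card V := by
  have := Fintype.ofFinite V
  have h := sum_valency (G := G)
  simp only [h2, Finset.sum_const, Finset.card_univ, smul_eq_mul,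
    ← Nat.card_eq_fintype_card] at h
  omega

/-- A finite connected two-regular graph is a cycle. -/
theorem Connected.exists_iso_cycleGraph [Finite V] (hG : G.Connected)
    (h2 : ∀ v, G.valency v = 2) :
    3 ≤ Nat.card V ∧ Nonempty (G ≃g cycleGraph (Nat.card V)) := by
  classical
  have := Fintype.ofFinite V
  have hcyc : ¬ G.IsAcyclic := by
    intro h
    have h1 := (IsTree.mk hG h).card_edgeFinset
    have h3 := card_edgeSet_of_valency_eq_two h2
    rw [Nat.card_eq_fintype_card, Nat.card_eq_fintype_card, ← edgeFinset_card] at h3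
    omega
  rw [isAcyclic_iff_free_cycleGraph] at hcyc
  push Not at hcyc
  obtain ⟨n, hn, hfree⟩ := hcyc
  obtain ⟨f⟩ := hfree
  obtain ⟨n, rfl⟩ : ∃ m, n = m + 3 := ⟨n - 3, by omega⟩
  -- The embedded cycle already uses both neighbours of each of its vertices, so its image is closed
  -- under adjacency and is everything.
  have hnbr : ∀ i, f '' (cycleGraph (n + 3)).neighborSet i = G.neighborSet (f i) := by
    intro i
    refine Set.eq_of_subset_of_ncard_le ?_ ?_
    · rintro _ ⟨j, hj, rfl⟩
      exact f.toHom.map_adj hj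
    · refine le_of_le_of_eq ?_ (Set.ncard_image_of_injective _ f.injective).symm
      change G.valency _ ≤ (cycleGraph (n + 3)).valency i
      rw [h2, valency_eq_degree, cycleGraph_degree_three_le]
  have hsurj : Function.Surjective f := by
    refine hG.preconnected.forall_of_adj_closed (p := fun x => ∃ i, f i = x) ⟨0, rfl⟩ ?_
    rintro _ b hb ⟨i, rfl⟩
    have : b ∈ f '' (cycleGraph (n + 3)).neighborSet i := (hnbr i).symm ▸ hb
    obtain ⟨j, -, hj⟩ := this
    exact ⟨j, hj⟩
  let F : cycleGraph (n + 3) ≃g G := ⟨Equiv.ofBijective f ⟨f.injective, hsurj⟩, by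
    intro i j
    refine ⟨fun h => ?_, fun h => f.toHom.map_adj h⟩
    have : f j ∈ f '' (cycleGraph (n + 3)).neighborSet i := (hnbr i).symm ▸ h
    obtain ⟨k, hk, hkj⟩ := this
    exact f.injective hkj ▸ hk⟩
  have hcard : Nat.card V = n + 3 := by rw [← Nat.card_congr F.toEquiv, Nat.card_fin]
  rw [hcard]
  exact ⟨by omega, ⟨F.symm⟩⟩

lemma cycleGraph_adj_iff_val {n : ℕ} (hn : 2 ≤ n) {u v : Fin n} :
    (cycleGraph n).Adj u v ↔ v.val = u.val + 1 ∨ u.val = v.val + 1 ∨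
      (u.val = 0 ∧ v.val + 1 = n) ∨ (v.val = 0 ∧ u.val + 1 = n) := by
  have hu := u.2
  have hv := v.2
  rw [cycleGraph_adj']
  rcases lt_trichotomy u v with h | rfl | h
  · have h' : u.val < v.val := h
    rw [Fin.coe_sub_iff_lt.2 h, Fin.coe_sub_iff_le.2 h.le]
    omega
  · rw [Fin.coe_sub_iff_le.2 le_rfl]
    omega
  · have h' : v.val < u.val := h
    rw [Fin.coe_sub_iff_lt.2 h, Fin.coe_sub_iff_le.2 h.le]
    omega

lemma distinguishingNumber_cycleGraph_le_two {n : ℕ} (hn : 6 ≤ n) :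
    (cycleGraph n).distinguishingNumber ≤ 2 := by
  refine distinguishingNumber_le_two
    -- Within the colour class 3 is the vertex with no neighbour, hence fixed. It has a common
    -- neighbour with 1 but, as `n ≥ 6`, none with 0, so 0 and 1 are fixed too.
    (fun i => decide (i.val = 0 ∨ i.val = 1 ∨ i.val = 3)) fun φ hφ => ?_
  by_contra! hcol
  refine hφ ?_
  have hcol' : ∀ i, (i.val = 0 ∨ i.val = 1 ∨ i.val = 3) ↔
      ((φ i).val = 0 ∨ (φ i).val = 1 ∨ (φ i).val = 3) := fun i => by
    simpa only [decide_eq_decide] using hcol i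
  have hadj : ∀ i j : Fin n, (cycleGraph n).Adj (φ i) (φ j) ↔ (cycleGraph n).Adj i j :=
    fun i j => φ.map_rel_iff
  simp only [cycleGraph_adj_iff_val (by omega : 2 ≤ n)] at hadj
  have hne : ∀ i j : Fin n, (φ i).val = (φ j).val → i.val = j.val := fun i j h =>
    congrArg Fin.val (φ.injective (Fin.ext h))
  let a : ∀ i, i < n → Fin n := fun i hi => ⟨i, hi⟩
  have h01 := (hadj (a 0 (by omega)) (a 1 (by omega))).2 (by simp [a])
  have h12 := (hadj (a 1 (by omega)) (a 2 (by omega))).2 (by simp [a])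
  have h23 := (hadj (a 2 (by omega)) (a 3 (by omega))).2 (by simp [a])
  have h03 := mt (hadj (a 0 (by omega)) (a 3 (by omega))).1 (by simp only [a]; omega)
  have h13 := mt (hadj (a 1 (by omega)) (a 3 (by omega))).1 (by simp only [a]; omega)
  have c0 := (hcol' (a 0 (by omega))).1 (by simp [a])
  have c1 := (hcol' (a 1 (by omega))).1 (by simp [a])
  have c3 := (hcol' (a 3 (by omega))).1 (by simp [a])
  have n01 := mt (hne (a 0 (by omega)) (a 1 (by omega))) (by simp [a])
  have n03 := mt (hne (a 0 (by omega)) (a 3 (by omega))) (by simp [a])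
  have n13 := mt (hne (a 1 (by omega)) (a 3 (by omega))) (by simp [a])
  have e0 : (φ (a 0 (by omega))).val = 0 ∧ (φ (a 1 (by omega))).val = 1 := by
    clear hadj hne hcol' hcol
    generalize (φ (a 0 (by omega))).val = x₀ at *
    generalize (φ (a 1 (by omega))).val = x₁ at *
    generalize (φ (a 2 (by omega))).val = x₂ at *
    generalize (φ (a 3 (by omega))).val = x₃ at *
    rcases c0 with rfl | rfl | rfl <;> rcases c1 with rfl | rfl | rfl <;>
      rcases c3 with rfl | rfl | rfl <;> first | contradiction | omega
  -- Two consecutive fixed vertices force the next one to be fixed.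
  have key : ∀ i, ∀ hi : i + 1 < n, (φ ⟨i, by omega⟩).val = i ∧ (φ ⟨i + 1, hi⟩).val = i + 1 := by
    intro i
    induction i with
    | zero => exact fun _ => e0
    | succ i ih =>
      intro hi
      obtain ⟨h1, h2⟩ := ih (by omega)
      have h3 := (hadj ⟨i + 1, by omega⟩ ⟨i + 2, hi⟩).2 (Or.inl rfl)
      have h4 := mt (hne ⟨i, by omega⟩ ⟨i + 2, hi⟩) (by simp)
      have h5 := mt (hne ⟨0, by omega⟩ ⟨i + 2, hi⟩) (by simp)
      have h6 : (φ ⟨0, by omega⟩).val = 0 := e0.1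
      refine ⟨h2, ?_⟩
      change (φ ⟨i + 2, hi⟩).val = i + 2
      clear hadj hne hcol' hcol
      omega
  refine DFunLike.ext _ _ fun i => Fin.ext ?_
  by_cases hi : i.val + 1 < n
  · exact (key i.val hi).1
  · have h := (key (n - 2) (by omega)).2
    have hi' : i = ⟨n - 2 + 1, by omega⟩ := Fin.ext (by change i.val = n - 2 + 1; omega)
    rw [hi']
    exact h

/-- Pull a distinguishing colouring back along an isomorphism. -/
lemma Iso.distinguishingNumber_le {W : Type*} {H : SimpleGraph W} (e : G ≃g H) :
    G.distinguishingNumber ≤ H.distinguishingNumber := by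
  refine le_iInf₂ fun k ⟨f, hf⟩ => iInf₂_le k ⟨f ∘ e, fun φ hφ => ?_⟩
  obtain ⟨w, hw⟩ := hf ((e.symm.trans φ).trans e) fun h => hφ <| DFunLike.ext _ _ fun v => by
    have := DFunLike.congr_fun h (e v)
    simpa using this
  exact ⟨e.symm w, by simpa using hw⟩

lemma iteratedLineGraph_of_valency_eq_two [Finite V] (hG : G.Connected)
    (h2 : ∀ v, G.valency v = 2) (k : ℕ) :
    (G.iteratedLineGraph k).2.Connected ∧ (∀ v, (G.iteratedLineGraph k).2.valency v = 2) ∧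
      Nat.card (G.iteratedLineGraph k).1 = Nat.card V := by
  induction k with
  | zero => exact ⟨hG, h2, rfl⟩
  | succ k ih =>
    have := finite_iteratedLineGraph (G := G) k
    obtain ⟨hc, hv, hcard⟩ := ih
    refine ⟨hc.lineGraph ?_, ?_, (card_edgeSet_of_valency_eq_two hv).trans hcard⟩
    · obtain ⟨v⟩ := hc.nonempty
      obtain ⟨w, hw⟩ := exists_adj_of_valency_pos (by rw [hv v]; norm_num)
      exact ⟨⟨s(v, w), hw⟩⟩
    · rintro ⟨⟨a, b⟩, hab⟩
      have h := valency_lineGraph (G := (G.iteratedLineGraph k).2) (u := a) (v := b) hab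
      rw [hv, hv] at h
      exact Nat.add_right_cancel h

end SimpleGraph

/-! ### The case distinction on degrees. -/

open SimpleGraph in
theorem theorem3 {V : Type u} [Finite V] (G : SimpleGraph V) (hconn : G.Connected)
    (hC3 : IsEmpty (G ≃g SimpleGraph.cycleGraph 3))
    (hC4 : IsEmpty (G ≃g SimpleGraph.cycleGraph 4))
    (hC5 : IsEmpty (G ≃g SimpleGraph.cycleGraph 5))
    (hK13 : IsEmpty (G ≃g completeBipartiteGraph (Fin 1) (Fin 3))) :
    ∃ K : ℕ, ∀ k : ℕ, K ≤ k → (G.iteratedLineGraph k).2.distinguishingNumber ≤ 2 := by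
  by_cases h3 : ∃ v, 3 ≤ G.valency v
  · obtain ⟨v, hv⟩ := h3
    exact (hconn.isProlific_of_three_le hv hK13).eventuallyTwoDistinguishable
  push Not at h3
  by_cases h1 : ∃ v, G.valency v ≤ 1
  · exact eventuallyTwoDistinguishable_of_path _ hconn (fun v => Nat.le_of_lt_succ (h3 v)) h1
      (Nat.lt_succ_self _)
  push Not at h1
  have h2 : ∀ v, G.valency v = 2 := fun v => by
    have := h1 v
    have := h3 v
    omega
  obtain ⟨hn3, ⟨e⟩⟩ := hconn.exists_iso_cycleGraph h2
  have hn : 6 ≤ Nat.card V := by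
    by_contra! hlt
    generalize Nat.card V = n at e hn3 hlt
    interval_cases n
    exacts [hC3.elim e, hC4.elim e, hC5.elim e]
  refine ⟨0, fun k _ => ?_⟩
  obtain ⟨hc, hv, hcard⟩ := iteratedLineGraph_of_valency_eq_two hconn h2 k
  have := finite_iteratedLineGraph (G := G) k
  obtain ⟨-, ⟨e'⟩⟩ := hc.exists_iso_cycleGraph hv
  rw [hcard] at e'
  exact e'.distinguishingNumber_le.trans (distinguishingNumber_cycleGraph_le_two hn)
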